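/- Let $K$ be a field and let $q\in K$ with $q\neq 1$ and $q\neq -1$ (for example $K=\mathbb{Q}(q)$ with $q$ an indeterminate). For $t\in K$ and $m\ge 1$ put $[m]_q=\frac{1-q^m}{1-q}$ and $[m]_{t,q}=\frac{1-tq^m}{1-q}$, and let the $(t,q)$-Euler numbers $E_n(t,q)\in K$, $n\ge 0$, be defined by the continued fraction of formal power series in $x$ $$\sum_{n\ge 0}E_n(t,q)\,x^n=\cfrac{1}{1-\cfrac{[1]_q[1]_{t,q}\,x}{1-\cfrac{[2]_q[2]_{t,q}\,x}{1-\cdots}}},$$ understood as the coefficientwise limit of its finite truncations. Then for every integer $n\ge 0$, $$E_n(-q,q)=\frac{1}{(1-q)^{2n}}\sum_{k=0}^{n}\left(\binom{2n}{n-k}-\binom{2n}{n-k-1}\right)(-1)^k\,\frac{q^{k^2}+q^{(k+1)^2}}{1+q},$$ where $\binom{2n}{-1}=0$. -/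

import Mathlib

namespace TQEuler

/-- The finite truncations of a continued fraction of S-type, as formal power series in `x`.
`truncSFraction c m h` starts at level `h` and contains the `m` coefficients
`c h, c (h + 1), …, c (h + m - 1)`:
`1 / (1 - c h * x / (1 - c (h + 1) * x / (⋯ / (1 - c (h + m - 1) * x))))`.
Every denominator has constant term `1`, so the inverse is a genuine inverse. -/
noncomputable def truncSFraction {K : Type*} [Field K] (c : ℕ → K) : ℕ → ℕ → PowerSeries K
  | 0, _ => 1
  | m + 1, h => (1 - PowerSeries.C (c h) * PowerSeries.X * truncSFraction c m (h + 1))⁻¹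

/-- The infinite S-fraction `1 / (1 - c 1 * x / (1 - c 2 * x / ⋯))` as a formal power series:
the coefficientwise (`x`-adic) limit of its truncations. The coefficient of `x ^ n` no longer
changes once `n` levels are present, see `coeff_truncSFraction_eq`. The value `c 0` is unused. -/
noncomputable def sFraction {K : Type*} [Field K] (c : ℕ → K) : PowerSeries K :=
  PowerSeries.mk fun n => PowerSeries.coeff n (truncSFraction c n 1)

theorem X_pow_dvd_truncSFraction_sub {K : Type*} [Field K] (c : ℕ → K) (m : ℕ) :
    ∀ h : ℕ, (PowerSeries.X : PowerSeries K) ^ (m + 1) ∣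
      truncSFraction c (m + 1) h - truncSFraction c m h := by
  have key : ∀ (a : K) (f : PowerSeries K),
      (1 - PowerSeries.C a * PowerSeries.X * f) *
        (1 - PowerSeries.C a * PowerSeries.X * f)⁻¹ = 1 := by
    intro a f
    exact PowerSeries.mul_inv_cancel _ (by simp)
  induction m with
  | zero =>
    intro h
    have h1 := key (c h) 1
    refine ⟨PowerSeries.C (c h) * (1 - PowerSeries.C (c h) * PowerSeries.X * 1)⁻¹, ?_⟩
    simp only [truncSFraction]
    linear_combination h1
  | succ m ih =>
    intro h
    obtain ⟨g, hg⟩ := ih (h + 1)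
    have h1 := key (c h) (truncSFraction c (m + 1) (h + 1))
    have h2 := key (c h) (truncSFraction c m (h + 1))
    have e : ∀ j : ℕ, truncSFraction c (j + 1) h =
        (1 - PowerSeries.C (c h) * PowerSeries.X * truncSFraction c j (h + 1))⁻¹ := fun _ => rfl
    rw [e (m + 1), e m]
    generalize truncSFraction c (m + 1) (h + 1) = A at *
    generalize truncSFraction c m (h + 1) = B at *
    generalize (1 - PowerSeries.C (c h) * PowerSeries.X * A)⁻¹ = A' at *
    generalize (1 - PowerSeries.C (c h) * PowerSeries.X * B)⁻¹ = B' at *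
    refine ⟨PowerSeries.C (c h) * g * A' * B', ?_⟩
    linear_combination (-A') * h2 + B' * h1 + PowerSeries.C (c h) * PowerSeries.X * A' * B' * hg

/-- The truncations stabilise coefficientwise to the S-fraction. -/
theorem coeff_truncSFraction_eq {K : Type*} [Field K] (c : ℕ → K) {n m : ℕ} (hnm : n ≤ m) :
    PowerSeries.coeff n (truncSFraction c m 1) = PowerSeries.coeff n (sFraction c) := by
  induction m, hnm using Nat.le_induction with
  | base => simp [sFraction]
  | succ m hm ih =>
    have h := PowerSeries.X_pow_dvd_iff.mp (X_pow_dvd_truncSFraction_sub c m 1) n (by omega)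
    rw [map_sub, sub_eq_zero] at h
    rw [h, ih]

/-- The `q`-integer `[n]_q = (1 - q ^ n) / (1 - q)`. -/
noncomputable def qInt {K : Type*} [Field K] (n : ℕ) (q : K) : K :=
  (1 - q ^ n) / (1 - q)

/-- The `(t, q)`-integer `[n]_{t,q} = (1 - t * q ^ n) / (1 - q)`. -/
noncomputable def tqInt {K : Type*} [Field K] (n : ℕ) (t q : K) : K :=
  (1 - t * q ^ n) / (1 - q)

/-- The `(t, q)`-Euler number `E_n(t, q)`: the coefficient of `x ^ n` in the S-fraction with
coefficients `[h]_q * [h]_{t,q}`, `h ≥ 1`. -/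
noncomputable def tqEuler {K : Type*} [Field K] (n : ℕ) (t q : K) : K :=
  PowerSeries.coeff n (sFraction fun h => qInt h q * tqInt h t q)

/-- The binomial coefficient with an integer lower index, equal to `0` if that index is
negative. -/
def binom (n : ℕ) (k : ℤ) : ℤ :=
  if 0 ≤ k then (n.choose k.toNat : ℤ) else 0

end TQEuler

/-! The tails of the S-fraction assemble into generating functions of weighted Dyck prefixes ending
at height `h`, with `x` marking down-steps. Removing the last step gives recurrences that determine
every coefficient (`coeff_prefixSeries_eq`), so it suffices to exhibit a solution.

For t = -q, up to the scalar 1/(1-q)^2 per up-step, the weights are λ_h = (1-q^h)(1+q^(h+1)). Let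
P_h be the monic orthogonal polynomials with xP_h = P_(h+1) + λ_h P_(h-1), L their moment
functional, and U_k the Chebyshev polynomials with xU_k = U_(k+1) + U_(k-1). The mixed moments
L(U_(h+2j) P_h) have a product form, and ballot numbers expand powers of x in the U_k, which gives
L(x^(h+2n) P_h). The case h = 0 is the claim. Only the resulting recurrences are checked; no
polynomials appear. -/

namespace TQEuler

open PowerSeries Finset

/-! ### S-fractions and weighted Dyck prefixes -/

section SFraction

variable {K : Type*} [Field K]

/-- The tail of an S-fraction starting at level `h`. -/
noncomputable def sFractionTail (c : ℕ → K) (h : ℕ) : PowerSeries K :=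
  PowerSeries.mk fun n => coeff n (truncSFraction c n h)

theorem sFractionTail_one (c : ℕ → K) : sFractionTail c 1 = sFraction c := rfl

theorem coeff_truncSFraction_eq_tail (c : ℕ → K) (h : ℕ) {n m : ℕ} (hnm : n ≤ m) :
    coeff n (truncSFraction c m h) = coeff n (sFractionTail c h) := by
  induction m, hnm using Nat.le_induction with
  | base => simp [sFractionTail]
  | succ m hm ih =>
    have h := X_pow_dvd_iff.mp (X_pow_dvd_truncSFraction_sub c m h) n (by omega)
    rw [map_sub, sub_eq_zero] at h
    rw [h, ih]

theorem X_pow_dvd_sFractionTail_sub (c : ℕ → K) (h m : ℕ) :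
    (X : PowerSeries K) ^ (m + 1) ∣ sFractionTail c h - truncSFraction c m h := by
  rw [X_pow_dvd_iff]
  intro n hn
  rw [map_sub, coeff_truncSFraction_eq_tail c h (by omega : n ≤ m), sub_self]

/-- The functional equation of an S-fraction. -/
theorem sFractionTail_eq (c : ℕ → K) (h : ℕ) :
    sFractionTail c h =
      1 + C (c h) * X * sFractionTail c h * sFractionTail c (h + 1) := by
  rw [← sub_eq_zero]
  ext n
  rw [map_zero]
  obtain ⟨u, hu⟩ := X_pow_dvd_sFractionTail_sub c h (n + 1)
  obtain ⟨v, hv⟩ := X_pow_dvd_sFractionTail_sub c (h + 1) n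
  have key : (1 - C (c h) * X * truncSFraction c n (h + 1)) * truncSFraction c (n + 1) h = 1 :=
    PowerSeries.mul_inv_cancel _ (by simp)
  refine X_pow_dvd_iff.mp (?_ : (X : PowerSeries K) ^ (n + 1) ∣ _) n (Nat.lt_succ_self n)
  -- The truncations satisfy the equation exactly (`key`); the witness collects the two truncation
  -- errors, of orders `n + 2` and `n + 1`.
  refine ⟨X * u * (1 - C (c h) * X * truncSFraction c n (h + 1))
    - C (c h) * X * sFractionTail c h * v, ?_⟩
  linear_combination (1 - C (c h) * X * truncSFraction c n (h + 1)) * hu + key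
    - C (c h) * X * sFractionTail c h * hv

/-- The generating function of weighted Dyck prefixes ending at height `h`, in which an up-step
to height `i` has weight `c i`. -/
noncomputable def prefixSeries (c : ℕ → K) (h : ℕ) : PowerSeries K :=
  (∏ i ∈ range h, C (c (i + 1)) * sFractionTail c (i + 1)) * sFractionTail c (h + 1)

theorem prefixSeries_zero (c : ℕ → K) : prefixSeries c 0 = 1 + X * prefixSeries c 1 := by
  have h := sFractionTail_eq c 1
  simp only [prefixSeries, prod_range_zero, prod_range_one]
  linear_combination h

/-- Split by the last step of the prefix: down from `h + 2`, or up from `h`. -/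
theorem prefixSeries_succ (c : ℕ → K) (h : ℕ) :
    prefixSeries c (h + 1) =
      X * prefixSeries c (h + 2) + C (c (h + 1)) * prefixSeries c h := by
  have e := sFractionTail_eq c (h + 2)
  simp only [prefixSeries, prod_range_succ]
  linear_combination
    ((∏ i ∈ range h, C (c (i + 1)) * sFractionTail c (i + 1)) * C (c (h + 1)) *
      sFractionTail c (h + 1)) * e

/-- The recurrences of weighted Dyck prefixes determine their generating functions. -/
theorem coeff_prefixSeries_eq (c : ℕ → K) (f : ℕ → ℕ → K) (h00 : f 0 0 = 1)
    (h0 : ∀ n, f 0 (n + 1) = f 1 n) (hs0 : ∀ h, f (h + 1) 0 = c (h + 1) * f h 0)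
    (hs : ∀ h n, f (h + 1) (n + 1) = f (h + 2) n + c (h + 1) * f h (n + 1)) (n : ℕ) :
    ∀ h, coeff n (prefixSeries c h) = f h n := by
  induction n with
  | zero =>
    intro h
    induction h with
    | zero => rw [prefixSeries_zero, h00]; simp
    | succ h ih =>
      rw [prefixSeries_succ, hs0, ← ih]; simp
  | succ n ihn =>
    intro h
    induction h with
    | zero =>
      rw [prefixSeries_zero, h0, ← ihn, map_add, coeff_succ_X_mul, coeff_one]; simp
    | succ h ih =>
      rw [prefixSeries_succ, hs, ← ihn, ← ih, map_add, coeff_succ_X_mul, coeff_C_mul]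

end SFraction

/-! ### Ballot numbers -/

section Ballot

theorem binom_succ (N : ℕ) (i : ℤ) : binom (N + 1) i = binom N i + binom N (i - 1) := by
  unfold binom
  rcases lt_trichotomy i 0 with hi | rfl | hi
  · rw [if_neg (by omega), if_neg (by omega), if_neg (by omega), add_zero]
  · simp
  · obtain ⟨k, rfl⟩ : ∃ k : ℕ, i = (k : ℤ) + 1 := ⟨(i - 1).toNat, by omega⟩
    rw [if_pos (by omega), if_pos (by omega), if_pos (by omega)]
    have e1 : ((k : ℤ) + 1).toNat = k + 1 := by omega
    have e2 : ((k : ℤ) + 1 - 1).toNat = k := by omega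
    rw [e1, e2, Nat.choose_succ_succ]
    push_cast
    ring

/-- The ballot number counting nonnegative lattice paths with `N` steps, `i` of them down. -/
def ballot (N : ℕ) (i : ℤ) : ℤ := binom N i - binom N (i - 1)

theorem ballot_succ (N : ℕ) (i : ℤ) : ballot (N + 1) i = ballot N i + ballot N (i - 1) := by
  simp only [ballot, binom_succ]
  ring

theorem ballot_zero (N : ℕ) : ballot N 0 = 1 := by
  simp [ballot, binom]

theorem ballot_neg_one (N : ℕ) : ballot N (-1) = 0 := by
  simp [ballot, binom]

/-- The two central binomials agree; this is the boundary condition U_(-1) = 0. -/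
theorem ballot_middle (n : ℕ) : ballot (2 * n + 1) ((n : ℤ) + 1) = 0 := by
  unfold ballot binom
  have e1 : ((n : ℤ) + 1).toNat = n + 1 := by omega
  have e2 : ((n : ℤ) + 1 - 1).toNat = n := by omega
  rw [if_pos (by omega), if_pos (by omega), e1, e2, Nat.choose_symm_half, sub_self]

end Ballot

/-! ### Mixed and power moments -/

section Moments

variable {K : Type*} [Field K]

/-- The mixed moments of the orthogonal polynomials with `h`-th recurrence coefficient
`(1 - q ^ h) * (1 + q ^ (h + 1))` against the Chebyshev polynomial of degree `h + 2 * j`. -/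
noncomputable def chebMoment (q : K) (h j : ℕ) : K :=
  (-1) ^ j * q ^ (j ^ 2) * (∏ i ∈ range h, (1 - q ^ (2 * j + 2 * i + 2))) *
    (1 + q ^ (2 * j + h + 1)) / (1 + q)

theorem chebMoment_zero_left (q : K) (j : ℕ) :
    chebMoment q 0 j = (-1) ^ j * ((q ^ (j ^ 2) + q ^ ((j + 1) ^ 2)) / (1 + q)) := by
  simp only [chebMoment, prod_range_zero]
  ring

theorem chebMoment_zero_zero (q : K) (hq : 1 + q ≠ 0) : chebMoment q 0 0 = 1 := by
  simp [chebMoment, hq]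

theorem chebMoment_one (q : K) (j : ℕ) :
    chebMoment q 1 j = chebMoment q 0 j + chebMoment q 0 (j + 1) := by
  simp only [chebMoment, prod_range_zero, prod_range_one]
  ring

theorem chebMoment_succ_zero (q : K) (h : ℕ) :
    chebMoment q (h + 1) 0 = (1 - q ^ (h + 1)) * (1 + q ^ (h + 2)) * chebMoment q h 0 := by
  simp only [chebMoment, prod_range_succ]
  ring

/-- Both sides are L(x U_(h+2j+2) P_(h+1)): on the left x acts on U, on the right on P. -/
theorem chebMoment_succ_succ (q : K) (h j : ℕ) :
    chebMoment q (h + 1) (j + 1) + chebMoment q (h + 1) j =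
      chebMoment q (h + 2) j +
        (1 - q ^ (h + 1)) * (1 + q ^ (h + 2)) * chebMoment q h (j + 1) := by
  have e : ∀ i, 2 * j + 2 * (i + 1) + 2 = 2 * (j + 1) + 2 * i + 2 := fun i => by ring
  -- Splitting off the factor `i = 0` turns the products at `j` into products at `j + 1`, so all
  -- four terms share one product over `range h`.
  have hp : ∀ n, ∏ i ∈ range (n + 1), (1 - q ^ (2 * j + 2 * i + 2)) =
      (∏ i ∈ range n, (1 - q ^ (2 * (j + 1) + 2 * i + 2))) * (1 - q ^ (2 * j + 2)) := by
    intro n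
    rw [prod_range_succ']
    simp only [e, mul_zero, add_zero]
  simp only [chebMoment]
  rw [hp, hp, prod_range_succ]
  ring

/-- The moment of `x ^ (h + 2 * n)` times the `h`-th orthogonal polynomial, obtained by expanding
the power of `x` in Chebyshev polynomials. -/
noncomputable def powMoment (q : K) (h n : ℕ) : K :=
  ∑ j ∈ range (n + 1), (ballot (h + 2 * n) ((n : ℤ) - j) : K) * chebMoment q h j

theorem powMoment_zero_right (q : K) (h : ℕ) : powMoment q h 0 = chebMoment q h 0 := by
  simp [powMoment, ballot_zero]

theorem powMoment_zero_succ (q : K) (n : ℕ) : powMoment q 0 (n + 1) = powMoment q 1 n := by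
  have e : ∀ j : ℕ, (ballot (0 + 2 * (n + 1)) (((n + 1 : ℕ) : ℤ) - j) : K) =
      (ballot (2 * n + 1) ((n : ℤ) + 1 - j) : K) + (ballot (2 * n + 1) ((n : ℤ) - j) : K) := by
    intro j
    rw [show 0 + 2 * (n + 1) = 2 * n + 1 + 1 by ring, ballot_succ]
    push_cast
    rw [show (n : ℤ) + 1 - j - 1 = n - j by ring]
  simp only [powMoment, e, chebMoment_one]
  simp only [add_mul _ _ (chebMoment _ _ _), sum_add_distrib, mul_add (Int.cast _ : K)]
  rw [sum_range_succ', sum_range_succ (fun j : ℕ => (ballot (2 * n + 1) ((n : ℤ) - j) : K) * _)]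
  have e1 : ∀ j : ℕ, (n : ℤ) + 1 - ((j + 1 : ℕ) : ℤ) = n - j := fun j => by push_cast; ring
  have e2 : (n : ℤ) - ((n + 1 : ℕ) : ℤ) = -1 := by push_cast; ring
  simp only [e1, e2, ballot_neg_one, Nat.cast_zero, sub_zero, ballot_middle, Int.cast_zero,
    zero_mul, add_zero, add_comm 1 (2 * n)]
  ring

theorem powMoment_succ_succ (q : K) (h n : ℕ) :
    powMoment q (h + 1) (n + 1) = powMoment q (h + 2) n +
      (1 - q ^ (h + 1)) * (1 + q ^ (h + 2)) * powMoment q h (n + 1) := by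
  set b : ℕ → K := fun j => (ballot (h + 2 * n + 2) ((n : ℤ) - j) : K) with hb
  set b0 : K := (ballot (h + 2 * n + 2) ((n : ℤ) + 1) : K) with hb0
  have e1 : ∀ j : ℕ, (n : ℤ) + 1 - ((j + 1 : ℕ) : ℤ) = n - j := fun j => by push_cast; ring
  -- Pascal's rule for ballot numbers, then a shift of `j` in one half; the leftover `b0` term is
  -- matched through `chebMoment_succ_zero`.
  have hl : powMoment q (h + 1) (n + 1) =
      (∑ j ∈ range (n + 1), b j * (chebMoment q (h + 1) (j + 1) + chebMoment q (h + 1) j)) +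
        b0 * chebMoment q (h + 1) 0 := by
    have e : ∀ j : ℕ, (ballot (h + 1 + 2 * (n + 1)) (((n + 1 : ℕ) : ℤ) - j) : K) =
        (ballot (h + 2 * n + 2) ((n : ℤ) + 1 - j) : K) + b j := by
      intro j
      rw [show h + 1 + 2 * (n + 1) = h + 2 * n + 2 + 1 by ring, ballot_succ]
      push_cast
      rw [show (n : ℤ) + 1 - j - 1 = n - j by ring]
    simp only [powMoment, e]
    simp only [add_mul _ _ (chebMoment _ _ _), sum_add_distrib, mul_add (b _)]
    rw [sum_range_succ', sum_range_succ (fun j : ℕ => b j * _)]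
    have e2 : b (n + 1) = 0 := by
      simp only [hb]
      rw [show (n : ℤ) - ((n + 1 : ℕ) : ℤ) = -1 by push_cast; ring, ballot_neg_one, Int.cast_zero]
    simp only [e1, e2, Nat.cast_zero, sub_zero, zero_mul, add_zero, ← hb0]
    ring
  have hr : powMoment q h (n + 1) =
      (∑ j ∈ range (n + 1), b j * chebMoment q h (j + 1)) + b0 * chebMoment q h 0 := by
    have e : h + 2 * (n + 1) = h + 2 * n + 2 := by ring
    simp only [powMoment, e]
    rw [sum_range_succ']
    simp only [Nat.cast_add, Nat.cast_one, Nat.cast_zero, sub_zero, hb, hb0, add_sub_add_right_eq_sub]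
  have hm : powMoment q (h + 2) n = ∑ j ∈ range (n + 1), b j * chebMoment q (h + 2) j := by
    have e : h + 2 + 2 * n = h + 2 * n + 2 := by ring
    simp only [powMoment, e, hb]
  rw [hl, hr, hm, mul_add, mul_sum, ← add_assoc, ← sum_add_distrib, chebMoment_succ_zero]
  congr 1
  · refine sum_congr rfl fun j _ => ?_
    rw [chebMoment_succ_succ]
    ring
  · ring

end Moments

end TQEuler

theorem proposition5p7 {K : Type*} [Field K] (q : K) (hq1 : q ≠ 1) (hq2 : 1 + q ≠ 0) (n : ℕ) :
    TQEuler.tqEuler n (-q) q =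
      1 / (1 - q) ^ (2 * n) *
        ∑ k ∈ Finset.range (n + 1),
          ((TQEuler.binom (2 * n) ((n : ℤ) - (k : ℤ)) -
              TQEuler.binom (2 * n) ((n : ℤ) - (k : ℤ) - 1) : ℤ) : K) *
            ((-1) ^ k * ((q ^ (k ^ 2) + q ^ ((k + 1) ^ 2)) / (1 + q))) := by
  set s : K := 1 / (1 - q) ^ 2 with hs
  set c : ℕ → K := fun h => TQEuler.qInt h q * TQEuler.tqInt h (-q) q with hc
  have hcs : ∀ h, c (h + 1) = s * ((1 - q ^ (h + 1)) * (1 + q ^ (h + 2))) := by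
    intro h
    simp only [hc, hs, TQEuler.qInt, TQEuler.tqInt, div_mul_div_comm, ← sq]
    ring
  have key := TQEuler.coeff_prefixSeries_eq c
    -- A prefix to height `h` with `n` down-steps has `n + h` up-steps, each contributing a factor
    -- `s`.
    (fun h n => s ^ (n + h) * TQEuler.powMoment q h n)
    (by simp [TQEuler.powMoment_zero_right, TQEuler.chebMoment_zero_zero q hq2])
    (fun n => by simp only [TQEuler.powMoment_zero_succ, add_zero])
    (fun h => by
      simp only [TQEuler.powMoment_zero_right, TQEuler.chebMoment_succ_zero, hcs]
      ring)
    (fun h n => by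
      simp only [TQEuler.powMoment_succ_succ, hcs]
      ring)
    n 0
  have hp : TQEuler.prefixSeries c 0 = TQEuler.sFraction c := by
    simp [TQEuler.prefixSeries, TQEuler.sFractionTail_one]
  rw [hp] at key
  have hsn : s ^ (n + 0) = 1 / (1 - q) ^ (2 * n) := by
    rw [hs, add_zero, div_pow, one_pow, pow_mul]
  rw [TQEuler.tqEuler, key, hsn]
  simp only [TQEuler.powMoment, TQEuler.ballot, TQEuler.chebMoment_zero_left, zero_add]
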